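/- Let $X$ be a separable complex Banach space, $T>0$, $\mathcal I=[0,T]$ with Lebesgue measure and $p\in[1,\infty)$. The generator of a strongly continuous semigroup $\{S(\tau)\}_{\tau\ge 0}$ of bounded linear operators on a Banach space is the operator $Ax:=\lim_{h\searrow 0}\frac1h\,(x-S(h)x)$, whose domain consists of all $x$ for which the limit exists; one writes $e^{-\tau A}:=S(\tau)$. For $M\ge 1$ and $\beta\in\mathbb R$, $A\in\mathcal G(M,\beta)$ means that $A$ is such a generator and $\|e^{-\tau A}\|\le M e^{\beta\tau}$ for all $\tau\ge 0$. Let $M\ge 1$, $\beta\in\mathbb R$, and let $\{C(t)\}_{t\in\mathcal I}$ be a family of generators of strongly continuous semigroups on $X$ such that $C(t)\in\mathcal G(M,\beta)$ for almost every $t\in\mathcal I$. Suppose that for every real $\xi>\beta$ and every $x\in X$ the (almost everywhere defined) function $\mathcal I\ni t\mapsto (C(t)+\xi)^{-1}x\in X$ is strongly measurable, i.e. almost everywhere equal to a pointwise limit of measurable simple functions. Let $\mathcal C$ be the induced multiplication operator in $L^p(\mathcal I,X)$, $$(\mathcal C f)(t):=C(t)f(t),\qquad \mathrm{dom}(\mathcal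 C):=\{f\in L^p(\mathcal I,X):\ f(t)\in\mathrm{dom}(C(t))\text{ for a.e. }t\in\mathcal I,\ t\mapsto C(t)f(t)\in L^p(\mathcal I,X)\}.$$ Then $\mathcal C$ is the generator of a strongly continuous semigroup on $L^p(\mathcal I,X)$, $\mathcal C\in\mathcal G(M,\beta)$, and for all $\tau\ge 0$ and $f\in L^p(\mathcal I,X)$ $$(e^{-\tau\mathcal C}f)(t)=e^{-\tau C(t)}f(t)\quad\text{for a.e. }t\in\mathcal I.$$ -/

import Mathlib

open MeasureTheory Filter Topology
open scoped NNReal ENNReal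

/-- A strongly continuous one-parameter semigroup `{T(t)}_{t ≥ 0}` of bounded linear operators. -/
structure C0Semigroup (X : Type*) [NormedAddCommGroup X] [NormedSpace ℂ X] where
  op : ℝ≥0 → X →L[ℂ] X
  op_zero : op 0 = ContinuousLinearMap.id ℂ X
  op_add : ∀ s t : ℝ≥0, op (s + t) = (op s).comp (op t)
  continuous_orbit : ∀ x : X, Continuous fun t : ℝ≥0 => op t x

namespace C0Semigroup

variable {X : Type*} [NormedAddCommGroup X] [NormedSpace ℂ X]

/-- The pairs `(x, y)` with `y = lim_{h ↘ 0} (x - T(h) x) / h`. -/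
def generatorGraph (S : C0Semigroup X) : Submodule ℂ (X × X) where
  carrier := {q | Tendsto (fun h : ℝ≥0 => ((h : ℝ) : ℂ)⁻¹ • (q.1 - S.op h q.1)) (𝓝[>] 0) (𝓝 q.2)}
  zero_mem' := by simp
  add_mem' := by
    intro a b ha hb
    refine (Tendsto.add ha hb).congr fun h => ?_
    rw [← smul_add, Prod.fst_add, map_add]
    congr 1
    abel
  smul_mem' := by
    intro c a ha
    refine (Tendsto.const_smul ha c).congr fun h => ?_
    rw [smul_comm, smul_sub, Prod.smul_fst, map_smul]

/-- The generator in the sign convention `A x = lim_{h ↘ 0} (x - T(h) x) / h`, defined for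
exactly those `x` for which the limit exists (see `mem_graph_generator`); thus `T(t) = e^{-tA}`. -/
noncomputable def generator (S : C0Semigroup X) : X →ₗ.[ℂ] X :=
  S.generatorGraph.toLinearPMap

theorem mem_graph_generator (S : C0Semigroup X) (x y : X) :
    (x, y) ∈ S.generator.graph ↔
      Tendsto (fun h : ℝ≥0 => ((h : ℝ) : ℂ)⁻¹ • (x - S.op h x)) (𝓝[>] 0) (𝓝 y) := by
  rw [generator, Submodule.toLinearPMap_graph_eq]
  · rfl
  · rintro ⟨u, v⟩ huv hu
    simp only at hu
    subst hu
    have h1 : Tendsto (fun _ : ℝ≥0 => (0 : X)) (𝓝[>] 0) (𝓝 v) := by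
      refine Tendsto.congr (fun h => ?_) huv
      simp
    exact (tendsto_nhds_unique h1 tendsto_const_nhds)

end C0Semigroup

namespace LinearPMap

section Generators

variable {X : Type*} [NormedAddCommGroup X] [NormedSpace ℂ X]

/-- `A` is the generator of some strongly continuous semigroup. -/
def IsGenerator (A : X →ₗ.[ℂ] X) : Prop :=
  ∃ S : C0Semigroup X, S.generator = A

open Classical in
/-- `e^{-τA}`: the semigroup with generator `A` at time `τ` (`0` if `A` is not a generator). -/
noncomputable def expNeg (A : X →ₗ.[ℂ] X) (τ : ℝ≥0) : X →L[ℂ] X :=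
  if h : A.IsGenerator then h.choose.op τ else 0

/-- The class `𝒢(M, γ)`: generators `A` with `‖e^{-τA}‖ ≤ M e^{γτ}` for all `τ ≥ 0`. -/
def IsOfClassG (A : X →ₗ.[ℂ] X) (M γ : ℝ) : Prop :=
  A.IsGenerator ∧ ∀ τ : ℝ≥0, ‖A.expNeg τ‖ ≤ M * Real.exp (γ * τ)

/-- The bounded operator `R` is a two-sided inverse of `A + ξ : dom A → X`. -/
def IsShiftInverse (A : X →ₗ.[ℂ] X) (ξ : ℂ) (R : X →L[ℂ] X) : Prop :=
  (∀ x : X, ∃ h : R x ∈ A.domain, A ⟨R x, h⟩ + ξ • R x = x) ∧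
    ∀ y : A.domain, R (A y + ξ • (y : X)) = y

open Classical in
/-- `(A + ξ)⁻¹` as a bounded operator on `X` (`0` if `-ξ` is not in the resolvent set of `A`). -/
noncomputable def shiftInv (A : X →ₗ.[ℂ] X) (ξ : ℂ) : X →L[ℂ] X :=
  if h : ∃ R, A.IsShiftInverse ξ R then h.choose else 0

end Generators

section Induced

variable {X : Type*} [NormedAddCommGroup X] [NormedSpace ℂ X]

/-- The pairs `(f, g)` in `L^p × L^p` with `f(t) ∈ dom C(t)` and `g(t) = C(t) f(t)` for a.e. `t`. -/
def inducedGraph (C : ℝ → X →ₗ.[ℂ] X) (p : ℝ≥0∞) (μ : Measure ℝ) :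
    Submodule ℂ (Lp X p μ × Lp X p μ) where
  carrier := {q | ∀ᵐ t ∂μ, ∃ h : q.1 t ∈ (C t).domain, C t ⟨q.1 t, h⟩ = q.2 t}
  zero_mem' := by
    filter_upwards [Lp.coeFn_zero X p μ] with t ht
    simp only [Prod.fst_zero, Prod.snd_zero, ht, Pi.zero_apply]
    exact ⟨(C t).domain.zero_mem, (C t).map_zero⟩
  add_mem' := by
    intro a b ha hb
    filter_upwards [ha, hb, Lp.coeFn_add a.1 b.1, Lp.coeFn_add a.2 b.2] with t hat hbt h1 h2
    obtain ⟨ha1, ha2⟩ := hat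
    obtain ⟨hb1, hb2⟩ := hbt
    simp only [Prod.fst_add, Prod.snd_add, h1, h2, Pi.add_apply]
    refine ⟨(C t).domain.add_mem ha1 hb1, ?_⟩
    rw [← ha2, ← hb2]
    exact (C t).map_add ⟨_, ha1⟩ ⟨_, hb1⟩
  smul_mem' := by
    intro c a ha
    filter_upwards [ha, Lp.coeFn_smul c a.1, Lp.coeFn_smul c a.2] with t hat h1 h2
    obtain ⟨ha1, ha2⟩ := hat
    simp only [Prod.smul_fst, Prod.smul_snd, h1, h2, Pi.smul_apply]
    refine ⟨(C t).domain.smul_mem c ha1, ?_⟩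
    rw [← ha2]
    exact (C t).map_smul c ⟨_, ha1⟩

/-- The multiplication operator `(𝒞 f)(t) = C(t) f(t)` in `L^p(μ; X)` with its maximal domain:
all `f` with `f(t) ∈ dom C(t)` for a.e. `t` and `t ↦ C(t) f(t)` in `L^p`
(see `mem_graph_induced`). -/
noncomputable def induced (C : ℝ → X →ₗ.[ℂ] X) (p : ℝ≥0∞) (μ : Measure ℝ) :
    Lp X p μ →ₗ.[ℂ] Lp X p μ :=
  (inducedGraph C p μ).toLinearPMap

theorem mem_graph_induced (C : ℝ → X →ₗ.[ℂ] X) (p : ℝ≥0∞) (μ : Measure ℝ) (f g : Lp X p μ) :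
    (f, g) ∈ (induced C p μ).graph ↔
      ∀ᵐ t ∂μ, ∃ h : f t ∈ (C t).domain, C t ⟨f t, h⟩ = g t := by
  rw [induced, Submodule.toLinearPMap_graph_eq]
  · rfl
  · rintro ⟨u, v⟩ huv hu
    simp only at hu
    subst hu
    refine Lp.ext ?_
    filter_upwards [huv, Lp.coeFn_zero X p μ] with t ht h0
    obtain ⟨h1, h2⟩ := ht
    rw [← h2]
    have : (⟨(0 : Lp X p μ) t, h1⟩ : (C t).domain) = 0 := Subtype.ext h0
    exact (congrArg (C t) this).trans ((C t).map_zero.trans h0.symm)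

end Induced

end LinearPMap

/-! ### Inversion of the Laplace transform -/

section Laplace

variable {E : Type*} [NormedAddCommGroup E] [NormedSpace ℝ E]

/-! The candidate semigroup on `Lp` acts fibrewise by e^{-τC(t)}. The obstacle is measurability in
t, since only the resolvents (C(t)+ξ)⁻¹ with ξ > β are assumed measurable. Each resolvent is the
Laplace transform of the fibre semigroup, and `tendsto_laplace_inversion` recovers e^{-τC(t)}x as a
limit of finite combinations of its values with coefficients independent of t, so measurability
passes to the limit (`aestronglyMeasurable_expNeg`). The same inversion shows that a generator
determines its semigroup, so the choice made in `expNeg` is harmless.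

The semigroup laws and the norm bound then hold fibrewise, and strong continuity is dominated
convergence, where p < ∞ enters. The generator is contained in 𝒞: an L^p limit of difference
quotients is an a.e. limit along a subsequence, and one sequence of steps suffices in each fibre
(`mem_graph_generator_of_tendsto_seq`). Equality follows because the generator plus β + 1 is onto,
while 𝒞 + β + 1 is injective, fibre by fibre (`generator_eq_induced`). -/

theorem norm_exp_neg_smul_le {u : ℝ → E} {K b : ℝ}
    (hK : ∀ s, 0 ≤ s → ‖u s‖ ≤ K * Real.exp (b * s)) (ξ : ℝ) :
    ∀ᵐ s ∂(volume.restrict (Set.Ioi (0 : ℝ))),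
      ‖Real.exp (-ξ * s) • u s‖ ≤ K * Real.exp (-(ξ - b) * s) := by
  filter_upwards [ae_restrict_mem measurableSet_Ioi] with s hs
  rw [norm_smul, Real.norm_eq_abs, Real.abs_exp]
  calc Real.exp (-ξ * s) * ‖u s‖ ≤ Real.exp (-ξ * s) * (K * Real.exp (b * s)) := by
        gcongr
        exact hK s (le_of_lt hs)
    _ = K * Real.exp (-(ξ - b) * s) := by
        rw [mul_left_comm, ← Real.exp_add]
        ring_nf

theorem integrableOn_exp_neg_smul {u : ℝ → E} (hu : Continuous u) {K b ξ : ℝ}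
    (hK : ∀ s, 0 ≤ s → ‖u s‖ ≤ K * Real.exp (b * s)) (hξ : b < ξ) :
    IntegrableOn (fun s => Real.exp (-ξ * s) • u s) (Set.Ioi 0) :=
  ((exp_neg_integrableOn_Ioi 0 (sub_pos.2 hξ)).const_mul K).mono' (by fun_prop)
    (norm_exp_neg_smul_le hK ξ)

theorem norm_integral_exp_neg_smul_le {u : ℝ → E} {K b ξ : ℝ}
    (hK : ∀ s, 0 ≤ s → ‖u s‖ ≤ K * Real.exp (b * s)) (hξ : b < ξ) :
    ‖∫ s in Set.Ioi 0, Real.exp (-ξ * s) • u s‖ ≤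
      K * ∫ s in Set.Ioi 0, Real.exp (-(ξ - b) * s) := by
  rw [← integral_const_mul]
  exact norm_integral_le_of_norm_le ((exp_neg_integrableOn_Ioi 0 (sub_pos.2 hξ)).const_mul K)
    (norm_exp_neg_smul_le hK ξ)

theorem image_exp_neg_Ioi : (fun s : ℝ => Real.exp (-s)) '' Set.Ioi 0 = Set.Ioo 0 1 := by
  ext v
  constructor
  · rintro ⟨s, hs, rfl⟩
    exact ⟨Real.exp_pos _, by simpa using hs⟩
  · rintro ⟨h0, h1⟩
    exact ⟨-Real.log v, neg_pos.2 (Real.log_neg h0 h1), by simp [Real.exp_log h0]⟩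

theorem hasDerivWithinAt_exp_neg (s : ℝ) (t : Set ℝ) :
    HasDerivWithinAt (fun s : ℝ => Real.exp (-s)) (-Real.exp (-s)) t s := by
  simpa using ((hasDerivAt_neg s).exp).hasDerivWithinAt

theorem injOn_exp_neg (t : Set ℝ) : Set.InjOn (fun s : ℝ => Real.exp (-s)) t :=
  fun _ _ _ _ h => neg_injective (Real.exp_injective h)

/-- The peak polynomial `(1 - (v - a)²)ⁿ`. -/
noncomputable def peakPoly (a : ℝ) (n : ℕ) : Polynomial ℝ :=
  (1 - (Polynomial.X - Polynomial.C a) ^ 2) ^ n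

theorem eval_peakPoly (a : ℝ) (n : ℕ) (v : ℝ) :
    (peakPoly a n).eval v = (1 - (v - a) ^ 2) ^ n := by
  simp [peakPoly]

/-- A monomial e^{-ks} only shifts the Laplace variable from ξ to ξ + k, so polynomial weights in
e^{-s} see nothing but the Laplace transform. -/
theorem integral_exp_smul_eval_exp_neg {u : ℝ → E} (hu : Continuous u) {K b ξ : ℝ}
    (hK : ∀ s, 0 ≤ s → ‖u s‖ ≤ K * Real.exp (b * s)) (hξ : b < ξ) (q : Polynomial ℝ) :
    ∫ s in Set.Ioi 0, Real.exp (-ξ * s) • q.eval (Real.exp (-s)) • u s =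
      ∑ k ∈ q.support, q.coeff k • ∫ s in Set.Ioi 0, Real.exp (-(ξ + k) * s) • u s := by
  simp_rw [← integral_smul]
  rw [← integral_finsetSum]
  · congr 1 with s
    rw [Polynomial.eval_eq_sum, Polynomial.sum, Finset.sum_smul, Finset.smul_sum]
    refine Finset.sum_congr rfl fun k _ => ?_
    rw [smul_smul, smul_smul, mul_left_comm, ← Real.exp_nat_mul, ← Real.exp_add]
    ring_nf
  · intro k _
    have hk : b < ξ + k := lt_of_lt_of_le hξ (le_add_of_nonneg_right k.cast_nonneg)
    exact (integrableOn_exp_neg_smul hu hK hk).smul (q.coeff k)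

/-- Inversion formula: the values of `u` are limits of linear combinations of values of the
Laplace transform of `u`, with coefficients that do not depend on `u`. -/
theorem tendsto_laplace_inversion [CompleteSpace E] {u : ℝ → E} (hu : Continuous u) {K b ξ τ : ℝ}
    (hK : ∀ s, 0 ≤ s → ‖u s‖ ≤ K * Real.exp (b * s)) (hξ : b < ξ) (hτ : 0 ≤ τ) :
    Tendsto (fun n : ℕ => (∫ v in Set.Icc (0 : ℝ) 1, (1 - (v - Real.exp (-τ)) ^ 2) ^ n)⁻¹ •
      ∑ k ∈ (peakPoly (Real.exp (-τ)) n).support, (peakPoly (Real.exp (-τ)) n).coeff k •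
        ∫ s in Set.Ioi 0, Real.exp (-(ξ + k) * s) • u s) atTop
      (𝓝 (Real.exp ((1 - ξ) * τ) • u τ)) := by
  set a := Real.exp (-τ) with ha
  have ha0 : 0 < a := Real.exp_pos _
  have ha1 : a ≤ 1 := Real.exp_le_one_iff.2 (neg_nonpos.2 hτ)
  -- Under v = e^{-s} the Jacobian e^{-s} turns this weight into the Laplace kernel e^{-ξs}.
  let h : ℝ → E := fun s => Real.exp ((1 - ξ) * s) • u s
  have hh : Continuous h := by fun_prop
  have hg : ∀ s, |-Real.exp (-s)| • h (-Real.log (Real.exp (-s))) =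
      Real.exp (-ξ * s) • u s := by
    intro s
    simp only [abs_neg, Real.abs_exp, Real.log_exp, neg_neg, h, smul_smul, ← Real.exp_add]
    ring_nf
  have hint : IntegrableOn (fun v => h (-Real.log v)) (Set.Icc 0 1) := by
    rw [integrableOn_Icc_iff_integrableOn_Ioo, ← image_exp_neg_Ioi,
      integrableOn_image_iff_integrableOn_abs_deriv_smul measurableSet_Ioi
        (fun s _ => hasDerivWithinAt_exp_neg s _) (injOn_exp_neg _)]
    simp_rw [hg]
    exact integrableOn_exp_neg_smul hu hK hξ
  -- On [0,1] the normalised powers of 1 - (v - a)² concentrate at v = a. The endpoint a = 1, that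
  -- is τ = 0, is allowed.
  have key := tendsto_setIntegral_pow_smul_of_unique_maximum_of_isCompact_of_integrableOn
    (μ := volume) (g := fun v => h (-Real.log v)) (x₀ := a) (c := fun v => 1 - (v - a) ^ 2)
    (isCompact_Icc (a := (0 : ℝ)) (b := 1)) (by fun_prop)
    (fun y _ hy => by
      have : 0 < (y - a) ^ 2 := by have := sub_ne_zero.2 hy; positivity
      simp only [sub_self]
      linarith)
    (fun y hy => by nlinarith [hy.1, hy.2])
    (by simp)
    (by rw [interior_Icc, closure_Ioo zero_ne_one]; exact ⟨ha0.le, ha1⟩)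
    hint
    (hh.continuousAt.comp (Real.continuousAt_log ha0.ne').neg).continuousWithinAt
  have hlim : h (-Real.log a) = Real.exp ((1 - ξ) * τ) • u τ := by simp [h, ha]
  rw [hlim] at key
  refine key.congr fun n => ?_
  congr 1
  rw [← integral_exp_smul_eval_exp_neg hu hK hξ, integral_Icc_eq_integral_Ioo,
    ← image_exp_neg_Ioi, integral_image_eq_integral_abs_deriv_smul measurableSet_Ioi
        (fun s _ => hasDerivWithinAt_exp_neg s _) (injOn_exp_neg _)]
  refine integral_congr_ae (Eventually.of_forall fun s => ?_)
  simp only [eval_peakPoly]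
  rw [smul_comm, hg s, smul_comm]

end Laplace

/-! ### Shift inverses in terms of graphs -/

namespace LinearPMap

variable {X : Type*} [NormedAddCommGroup X] [NormedSpace ℂ X]

theorem isShiftInverse_iff {A : X →ₗ.[ℂ] X} {ξ : ℂ} {R : X →L[ℂ] X} :
    A.IsShiftInverse ξ R ↔ (∀ x, (R x, x - ξ • R x) ∈ A.graph) ∧
      ∀ y z, (y, z) ∈ A.graph → R (z + ξ • y) = y := by
  simp only [IsShiftInverse, mem_graph_iff]
  refine and_congr (forall_congr' fun x => ⟨?_, ?_⟩) ⟨?_, ?_⟩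
  · rintro ⟨h, hx⟩
    exact ⟨⟨R x, h⟩, rfl, eq_sub_of_add_eq hx⟩
  · rintro ⟨⟨y, hy⟩, rfl, hx⟩
    exact ⟨hy, eq_sub_iff_add_eq.1 hx⟩
  · rintro h y z ⟨w, rfl, rfl⟩
    exact h w
  · exact fun h w => h _ _ ⟨w, rfl, rfl⟩

theorem IsShiftInverse.eq {A : X →ₗ.[ℂ] X} {ξ : ℂ} {R R' : X →L[ℂ] X}
    (h : A.IsShiftInverse ξ R) (h' : A.IsShiftInverse ξ R') : R = R' := by
  ext x
  simpa using ((isShiftInverse_iff.1 h').2 _ _ ((isShiftInverse_iff.1 h).1 x)).symm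

theorem IsShiftInverse.shiftInv_eq {A : X →ₗ.[ℂ] X} {ξ : ℂ} {R : X →L[ℂ] X}
    (h : A.IsShiftInverse ξ R) : A.shiftInv ξ = R := by
  have h' : ∃ R, A.IsShiftInverse ξ R := ⟨R, h⟩
  rw [shiftInv, dif_pos h']
  exact h'.choose_spec.eq h

/-- An operator with a shift inverse has no proper extension whose shift is injective. -/
theorem IsShiftInverse.eq_of_graph_le {A B : X →ₗ.[ℂ] X} {ξ : ℂ} {R : X →L[ℂ] X}
    (h : A.IsShiftInverse ξ R) (hle : A.graph ≤ B.graph)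
    (hinj : ∀ x, (x, -(ξ • x)) ∈ B.graph → x = 0) : A = B := by
  refine eq_of_eq_graph (le_antisymm hle ?_)
  rintro ⟨x, y⟩ hxy
  have h1 := (isShiftInverse_iff.1 h).1 (y + ξ • x)
  have h2 := hinj (x - R (y + ξ • x)) (by
    convert B.graph.sub_mem hxy (hle h1) using 1
    ext
    · rfl
    · simp only [Prod.snd_sub, smul_sub]
      abel)
  rw [← sub_eq_zero.1 h2] at h1
  simpa using h1

end LinearPMap

/-! ### Basic theory of strongly continuous semigroups -/

namespace C0Semigroup

variable {X : Type*} [NormedAddCommGroup X] [NormedSpace ℂ X]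

theorem mem_graph_generator_iff (S : C0Semigroup X) (x y : X) :
    (x, y) ∈ S.generator.graph ↔
      Tendsto (fun h : ℝ≥0 => (h : ℝ)⁻¹ • (x - S.op h x)) (𝓝[>] 0) (𝓝 y) := by
  rw [mem_graph_generator]
  simp_rw [← Complex.ofReal_inv, Complex.coe_smul]

theorem op_comm (S : C0Semigroup X) (s t : ℝ≥0) (x : X) :
    S.op s (S.op t x) = S.op t (S.op s x) := by
  rw [← ContinuousLinearMap.comp_apply, ← ContinuousLinearMap.comp_apply, ← S.op_add,
    ← S.op_add, add_comm]

theorem continuous_orbit_toNNReal (S : C0Semigroup X) (x : X) :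
    Continuous fun s : ℝ => S.op s.toNNReal x :=
  (S.continuous_orbit x).comp continuous_real_toNNReal

/-- Every strongly continuous semigroup on a Banach space is exponentially bounded. -/
theorem exists_norm_op_le [CompleteSpace X] (S : C0Semigroup X) :
    ∃ K b : ℝ, ∀ t : ℝ≥0, ‖S.op t‖ ≤ K * Real.exp (b * t) := by
  obtain ⟨K', hK'⟩ := banach_steinhaus (g := fun t : Set.Icc (0 : ℝ≥0) 1 => S.op t) fun x => by
    obtain ⟨C, hC⟩ := isCompact_Icc.exists_bound_of_continuousOn
      (s := Set.Icc (0 : ℝ≥0) 1) (S.continuous_orbit x).continuousOn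
    exact ⟨C, fun t => hC t t.2⟩
  set K := max K' 1
  have hK1 : 1 ≤ K := le_max_right _ _
  have hK0 : 0 < K := one_pos.trans_le hK1
  have hK : ∀ t : ℝ≥0, t ≤ 1 → ‖S.op t‖ ≤ K := fun t ht =>
    (hK' ⟨t, zero_le, ht⟩).trans (le_max_left _ _)
  have hn : ∀ (n : ℕ) (t : ℝ≥0), t ≤ 1 → ‖S.op (n + t)‖ ≤ K ^ n * K := by
    intro n t ht
    induction n with
    | zero => simpa using hK t ht
    | succ n ih =>
      have : ((n + 1 : ℕ) : ℝ≥0) + t = 1 + (n + t) := by push_cast; ring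
      rw [this, S.op_add, pow_succ', mul_assoc]
      exact (ContinuousLinearMap.opNorm_comp_le _ _).trans
        (mul_le_mul (hK 1 le_rfl) ih (norm_nonneg _) hK0.le)
  -- Split t into integer and fractional parts; K ≥ 1 gives Kⁿ = e^{n log K} ≤ e^{t log K} for n =
  -- ⌊t⌋.
  refine ⟨K, Real.log K, fun t => ?_⟩
  have hfl : (⌊t⌋₊ : ℝ≥0) ≤ t := Nat.floor_le zero_le
  have h1 := hn ⌊t⌋₊ (t - ⌊t⌋₊) (tsub_le_iff_left.2 (Nat.lt_floor_add_one t).le)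
  rw [add_tsub_cancel_of_le hfl] at h1
  refine h1.trans ?_
  rw [mul_comm]
  gcongr
  rw [← Real.rpow_natCast, Real.rpow_def_of_pos hK0]
  gcongr
  · exact Real.log_nonneg hK1
  · exact_mod_cast hfl

theorem norm_orbit_le {S : C0Semigroup X} {K b : ℝ}
    (hK : ∀ t : ℝ≥0, ‖S.op t‖ ≤ K * Real.exp (b * t)) (x : X) (s : ℝ) (hs : 0 ≤ s) :
    ‖S.op s.toNNReal x‖ ≤ K * ‖x‖ * Real.exp (b * s) := by
  have h := (S.op s.toNNReal).le_of_opNorm_le (hK _) x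
  rw [Real.coe_toNNReal s hs] at h
  linarith

/-- Translating the integration variable by h makes the orbit of the Laplace integral explicitly
differentiable in h. -/
theorem op_integral_exp_neg_smul [CompleteSpace X] {S : C0Semigroup X} {K b ξ : ℝ}
    (hK : ∀ t : ℝ≥0, ‖S.op t‖ ≤ K * Real.exp (b * t)) (hξ : b < ξ) (x : X) (h : ℝ≥0) :
    S.op h (∫ s in Set.Ioi (0 : ℝ), Real.exp (-ξ * s) • S.op s.toNNReal x) =
      Real.exp (ξ * h) • ((∫ s in Set.Ioi (0 : ℝ), Real.exp (-ξ * s) • S.op s.toNNReal x) -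
        ∫ s in (0 : ℝ)..h, Real.exp (-ξ * s) • S.op s.toNNReal x) := by
  have hint := integrableOn_exp_neg_smul (S.continuous_orbit_toNNReal x) (norm_orbit_le hK x) hξ
  rw [← intervalIntegral.integral_Ioi_sub_Ioi hint h.coe_nonneg, sub_sub_cancel,
    ← ContinuousLinearMap.integral_comp_comm _ hint, ← integral_smul]
  have := (measurePreserving_add_right volume (h : ℝ)).setIntegral_preimage_emb
    (measurableEmbedding_addRight _)
    (fun s => Real.exp (ξ * h) • Real.exp (-ξ * s) • S.op s.toNNReal x) (Set.Ioi h)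
  rw [Set.preimage_add_const_Ioi, sub_self] at this
  rw [← this]
  refine setIntegral_congr_fun measurableSet_Ioi fun s hs => ?_
  rw [Real.toNNReal_add (le_of_lt hs) h.coe_nonneg, Real.toNNReal_coe, S.op_add,
    ContinuousLinearMap.comp_apply, S.op_comm, smul_smul, ← Real.exp_add,
    ContinuousLinearMap.map_smul_of_tower]
  ring_nf

/-- The Laplace transform of a semigroup is the shift inverse of its generator. -/
theorem exists_isShiftInverse [CompleteSpace X] {S : C0Semigroup X} {K b ξ : ℝ}
    (hK : ∀ t : ℝ≥0, ‖S.op t‖ ≤ K * Real.exp (b * t)) (hξ : b < ξ) :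
    ∃ R : X →L[ℂ] X, S.generator.IsShiftInverse (ξ : ℂ) R ∧
      (∀ x, R x = ∫ s in Set.Ioi (0 : ℝ), Real.exp (-ξ * s) • S.op s.toNNReal x) ∧
      ∀ h x, R (S.op h x) = S.op h (R x) := by
  have hint := fun x =>
    integrableOn_exp_neg_smul (S.continuous_orbit_toNNReal x) (norm_orbit_le hK x) hξ
  let R : X →L[ℂ] X := LinearMap.mkContinuous
    { toFun := fun x => ∫ s in Set.Ioi (0 : ℝ), Real.exp (-ξ * s) • S.op s.toNNReal x
      map_add' := fun x y => by
        simp only [map_add, smul_add]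
        exact integral_add (hint x) (hint y)
      map_smul' := fun c x => by
        simp only [map_smul, RingHom.id_apply]
        rw [← integral_smul]
        simp_rw [smul_comm c] }
    (K * ∫ s in Set.Ioi (0 : ℝ), Real.exp (-(ξ - b) * s))
    (fun x => (norm_integral_exp_neg_smul_le (norm_orbit_le hK x) hξ).trans_eq (by ring))
  have hR : ∀ x, R x = ∫ s in Set.Ioi (0 : ℝ), Real.exp (-ξ * s) • S.op s.toNNReal x :=
    fun x => rfl
  have hcomm : ∀ h x, R (S.op h x) = S.op h (R x) := by
    intro h x
    rw [hR, hR, ← ContinuousLinearMap.integral_comp_comm _ (hint x)]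
    simp_rw [ContinuousLinearMap.map_smul_of_tower, S.op_comm h]
  have hgraph : ∀ x, (R x, x - (ξ : ℂ) • R x) ∈ S.generator.graph := by
    intro x
    rw [mem_graph_generator_iff]
    have hcont : Continuous fun s : ℝ => Real.exp (-ξ * s) • S.op s.toNNReal x :=
      (by fun_prop : Continuous fun s : ℝ => Real.exp (-ξ * s)).smul
        (S.continuous_orbit_toNNReal x)
    have hF := hcont.integral_hasStrictDerivAt 0 0 |>.hasDerivAt
    have hE : HasDerivAt (fun h : ℝ => Real.exp (ξ * h)) ξ 0 := by
      simpa using ((hasDerivAt_id (0 : ℝ)).const_mul ξ).exp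
    -- The orbit h ↦ S(h)Rx equals e^{ξh}(Rx - ∫₀ʰ) for h ≥ 0; minus its derivative at 0 is x - ξRx.
    have hG := (hE.smul (hF.const_sub (R x))).neg.tendsto_slope_zero_right
    have hcoe : Tendsto (fun h : ℝ≥0 => (h : ℝ)) (𝓝[>] 0) (𝓝[>] 0) :=
      tendsto_nhdsWithin_iff.2 ⟨(NNReal.continuous_coe.tendsto' 0 0 rfl).mono_left
        nhdsWithin_le_nhds, eventually_mem_nhdsWithin.mono fun h hh => NNReal.coe_pos.2 hh⟩
    have := hG.comp hcoe
    convert this using 2 with h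
    · simp only [Function.comp, zero_add, Pi.neg_apply, Pi.smul_apply', mul_zero, Real.exp_zero,
        one_smul, intervalIntegral.integral_same, sub_zero, neg_sub_neg]
      rw [hR, op_integral_exp_neg_smul hK hξ]
    · simp [S.op_zero, Complex.coe_smul, neg_add_eq_sub]
  refine ⟨R, LinearPMap.isShiftInverse_iff.2 ⟨hgraph, fun y z hyz => ?_⟩, hR, hcomm⟩
  rw [mem_graph_generator_iff] at hyz
  have h1 := (R.continuous.tendsto z).comp hyz
  have h2 := (S.mem_graph_generator_iff _ _).1 (hgraph y)
  have h3 : R z = y - (ξ : ℂ) • R y := by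
    refine tendsto_nhds_unique h1 (h2.congr fun h => ?_)
    simp only [Function.comp]
    rw [ContinuousLinearMap.map_smul_of_tower, map_sub, hcomm]
  rw [map_add, map_smul, h3, sub_add_cancel]

/-- To be in the graph of the generator, convergence along one sequence suffices. -/
theorem mem_graph_generator_of_tendsto_seq [CompleteSpace X] (S : C0Semigroup X) {x y : X}
    {h : ℕ → ℝ≥0} (hh : Tendsto h atTop (𝓝[>] 0))
    (hx : Tendsto (fun n => (h n : ℝ)⁻¹ • (x - S.op (h n) x)) atTop (𝓝 y)) :
    (x, y) ∈ S.generator.graph := by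
  obtain ⟨K, b, hK⟩ := S.exists_norm_op_le
  obtain ⟨R, hR, -, hcomm⟩ := exists_isShiftInverse hK (lt_add_one b)
  rw [LinearPMap.isShiftInverse_iff] at hR
  have h1 := (R.continuous.tendsto y).comp hx
  have h2 := ((S.mem_graph_generator_iff _ _).1 (hR.1 x)).comp hh
  -- R x is in the domain, so its quotients converge along every sequence; comparing limits puts x
  -- in the range of R.
  have h3 : R y = x - ((b + 1 : ℝ) : ℂ) • R x := by
    refine tendsto_nhds_unique h1 (h2.congr fun n => ?_)
    simp only [Function.comp]
    rw [ContinuousLinearMap.map_smul_of_tower, map_sub, hcomm]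
  have h4 : R (y + ((b + 1 : ℝ) : ℂ) • x) = x := by
    rw [map_add, map_smul, h3, sub_add_cancel]
  have h5 := hR.1 (y + ((b + 1 : ℝ) : ℂ) • x)
  rwa [h4, add_sub_cancel_right] at h5

/-- A strongly continuous semigroup is determined by its generator. -/
theorem op_eq_of_generator_eq [CompleteSpace X] {S S' : C0Semigroup X}
    (h : S.generator = S'.generator) : S.op = S'.op := by
  obtain ⟨K, b, hK⟩ := S.exists_norm_op_le
  obtain ⟨K', b', hK'⟩ := S'.exists_norm_op_le
  have hlap : ∀ ξ : ℝ, max b b' < ξ → ∀ x,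
      ∫ s in Set.Ioi (0 : ℝ), Real.exp (-ξ * s) • S.op s.toNNReal x =
        ∫ s in Set.Ioi (0 : ℝ), Real.exp (-ξ * s) • S'.op s.toNNReal x := by
    intro ξ hξ x
    obtain ⟨R, hR, hR1, -⟩ := exists_isShiftInverse hK ((le_max_left _ _).trans_lt hξ)
    obtain ⟨R', hR', hR1', -⟩ := exists_isShiftInverse hK' ((le_max_right _ _).trans_lt hξ)
    rw [h] at hR
    rw [← hR1, ← hR1', hR.eq hR']
  ext τ x
  have hlt := lt_add_one (max b b')
  have h1 := tendsto_laplace_inversion (S.continuous_orbit_toNNReal x) (norm_orbit_le hK x)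
    ((le_max_left _ _).trans_lt hlt) τ.2
  have h2 := tendsto_laplace_inversion (S'.continuous_orbit_toNNReal x) (norm_orbit_le hK' x)
    ((le_max_right _ _).trans_lt hlt) τ.2
  have h3 := tendsto_nhds_unique h1 (h2.congr fun n => by
    congr 1
    refine Finset.sum_congr rfl fun k _ => ?_
    rw [hlap _ (hlt.trans_le (le_add_of_nonneg_right k.cast_nonneg))])
  simpa using smul_right_injective X (Real.exp_pos _).ne' h3

theorem isGenerator_generator (S : C0Semigroup X) : S.generator.IsGenerator := ⟨S, rfl⟩

theorem expNeg_generator [CompleteSpace X] (S : C0Semigroup X) (τ : ℝ≥0) :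
    S.generator.expNeg τ = S.op τ := by
  rw [LinearPMap.expNeg, dif_pos S.isGenerator_generator,
    op_eq_of_generator_eq S.isGenerator_generator.choose_spec]

end C0Semigroup

theorem LinearPMap.IsOfClassG.exists_semigroup {X : Type*} [NormedAddCommGroup X]
    [NormedSpace ℂ X] [CompleteSpace X] {A : X →ₗ.[ℂ] X} {M γ : ℝ} (h : A.IsOfClassG M γ) :
    ∃ S : C0Semigroup X, S.generator = A ∧ (∀ τ, A.expNeg τ = S.op τ) ∧
      ∀ τ : ℝ≥0, ‖S.op τ‖ ≤ M * Real.exp (γ * τ) := by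
  obtain ⟨⟨S, rfl⟩, h2⟩ := h
  exact ⟨S, rfl, S.expNeg_generator, fun τ => by simpa only [S.expNeg_generator] using h2 τ⟩

/-- Dominated convergence in `L^p`. -/
theorem tendsto_Lp_of_dominated {α X : Type*} [MeasurableSpace α] {μ : Measure α}
    [NormedAddCommGroup X] {p : ℝ≥0∞} [Fact (1 ≤ p)] (hp : p ≠ ∞) {F : ℕ → Lp X p μ}
    {f : Lp X p μ} {bound : α → ℝ} (hbound : MemLp bound p μ)
    (hle : ∀ n, ∀ᵐ t ∂μ, ‖F n t - f t‖ ≤ bound t)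
    (hlim : ∀ᵐ t ∂μ, Tendsto (fun n => F n t) atTop (𝓝 (f t))) :
    Tendsto F atTop (𝓝 f) := by
  have hp0 : p ≠ 0 := (zero_lt_one.trans_le Fact.out).ne'
  have hpos : 0 < p.toReal := ENNReal.toReal_pos hp0 hp
  rw [Lp.tendsto_Lp_iff_tendsto_eLpNorm']
  simp_rw [eLpNorm_eq_lintegral_rpow_enorm_toReal hp0 hp]
  have h0 : Tendsto (fun n => ∫⁻ t, ‖(F n - f : α → X) t‖ₑ ^ p.toReal ∂μ) atTop (𝓝 0) := by
    have := tendsto_lintegral_filter_of_dominated_convergence' (μ := μ) (l := atTop)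
      (F := fun n t => ‖(F n - f : α → X) t‖ₑ ^ p.toReal) (f := fun _ => 0)
      (fun t => ‖bound t‖ₑ ^ p.toReal)
      (Eventually.of_forall fun n => (((Lp.aestronglyMeasurable (F n)).sub
        (Lp.aestronglyMeasurable f)).enorm.pow_const _))
      (Eventually.of_forall fun n => by
        filter_upwards [hle n] with t ht
        have : ‖(F n - f : α → X) t‖ₑ ≤ ‖bound t‖ₑ :=
          enorm_le_iff_norm_le.2 (ht.trans (le_abs_self _))
        gcongr)
      (lintegral_rpow_enorm_lt_top_of_eLpNorm_lt_top hp0 hp hbound.2).ne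
      (by
        filter_upwards [hlim] with t ht
        have h1 : Tendsto (fun n => ‖F n t - f t‖ₑ) atTop (𝓝 0) := by
          have := (ht.sub_const (f t)).enorm
          simpa using this
        have := h1.ennrpow_const p.toReal
        rwa [ENNReal.zero_rpow_of_pos hpos] at this)
    simpa using this
  have := h0.ennrpow_const (1 / p.toReal)
  rwa [ENNReal.zero_rpow_of_pos (by positivity)] at this

/-! ### Measurable families of operators -/

section Families

variable {α X : Type*} [MeasurableSpace α] {μ : Measure α} [NormedAddCommGroup X]
  [NormedSpace ℂ X]

/-- For simple f this is a finite sum of indicators; the general case is a pointwise limit, as each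
B(t) is continuous. -/
theorem aestronglyMeasurable_family_apply {B : α → X →L[ℂ] X}
    (hB : ∀ x, AEStronglyMeasurable (fun t => B t x) μ) {f : α → X}
    (hf : AEStronglyMeasurable f μ) : AEStronglyMeasurable (fun t => B t (f t)) μ := by
  have hs : ∀ s : SimpleFunc α X, AEStronglyMeasurable (fun t => B t (s t)) μ := by
    intro s
    have : (fun t => B t (s t)) =
        fun t => ∑ x ∈ s.range, (s ⁻¹' {x}).indicator (fun t => B t x) t := by
      ext t
      rw [Finset.sum_eq_single (s t)]
      · simp
      · exact fun x _ hx => Set.indicator_of_notMem (fun h => hx h.symm) _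
      · exact fun h => absurd (s.mem_range_self t) h
    rw [this]
    exact Finset.aestronglyMeasurable_fun_sum _ fun x _ =>
      (hB x).indicator (s.measurableSet_fiber x)
  refine aestronglyMeasurable_of_tendsto_ae atTop
    (fun n => hs (hf.stronglyMeasurable_mk.approx n)) ?_
  filter_upwards [hf.ae_eq_mk] with t ht
  rw [ht]
  exact ((B t).continuous.tendsto _).comp (hf.stronglyMeasurable_mk.tendsto_approx t)

/-- A bounded measurable family of operators acts on `L^p`. -/
theorem exists_Lp_multiplication (p : ℝ≥0∞) [Fact (1 ≤ p)] {B : α → X →L[ℂ] X} {K : ℝ}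
    (hK0 : 0 ≤ K) (hK : ∀ᵐ t ∂μ, ‖B t‖ ≤ K)
    (hB : ∀ x, AEStronglyMeasurable (fun t => B t x) μ) :
    ∃ L : Lp X p μ →L[ℂ] Lp X p μ, (∀ f, ∀ᵐ t ∂μ, L f t = B t (f t)) ∧ ‖L‖ ≤ K := by
  have hle : ∀ f : Lp X p μ, ∀ᵐ t ∂μ, ‖B t (f t)‖ ≤ K * ‖f t‖ := fun f => by
    filter_upwards [hK] with t ht using (B t).le_of_opNorm_le ht _
  have hmem : ∀ f : Lp X p μ, MemLp (fun t => B t (f t)) p μ := fun f =>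
    (Lp.memLp f).of_le_mul (aestronglyMeasurable_family_apply hB (Lp.aestronglyMeasurable f))
      (hle f)
  have hcoe := fun f => (hmem f).coeFn_toLp
  refine ⟨LinearMap.mkContinuous
    { toFun := fun f => (hmem f).toLp _
      map_add' := fun f g => by
        refine Lp.ext ?_
        filter_upwards [hcoe (f + g), hcoe f, hcoe g, Lp.coeFn_add f g,
          Lp.coeFn_add ((hmem f).toLp _) ((hmem g).toLp _)] with t h1 h2 h3 h4 h5
        rw [h1, h5, h4, Pi.add_apply, Pi.add_apply, map_add, h2, h3]
      map_smul' := fun c f => by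
        refine Lp.ext ?_
        filter_upwards [hcoe (c • f), hcoe f, Lp.coeFn_smul c f,
          Lp.coeFn_smul c ((hmem f).toLp _)] with t h1 h2 h3 h4
        rw [h1, RingHom.id_apply, h4, h3, Pi.smul_apply, Pi.smul_apply, map_smul, h2] }
    K (fun f => ?_), hcoe, LinearMap.mkContinuous_norm_le _ hK0 _⟩
  refine Lp.norm_le_mul_norm_of_ae_le_mul ?_
  filter_upwards [hcoe f, hle f] with t h1 h2
  change ‖(hmem f).toLp _ t‖ ≤ _
  rwa [h1]

end Families

/-! ### The semigroup induced on `L^p` -/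

namespace LinearPMap

theorem aestronglyMeasurable_expNeg {α X : Type*} [MeasurableSpace α] {μ : Measure α}
    [NormedAddCommGroup X] [NormedSpace ℂ X] [CompleteSpace X] {C : α → X →ₗ.[ℂ] X} {M β : ℝ}
    (hclass : ∀ᵐ t ∂μ, (C t).IsOfClassG M β)
    (hmeas : ∀ ξ : ℝ, β < ξ → ∀ x : X,
      AEStronglyMeasurable (fun t => (C t).shiftInv (ξ : ℂ) x) μ) (τ : ℝ≥0) (x : X) :
    AEStronglyMeasurable (fun t => (C t).expNeg τ x) μ := by
  have hβ := lt_add_one β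
  have hβk : ∀ k : ℕ, β < β + 1 + k := fun k =>
    hβ.trans_le (le_add_of_nonneg_right k.cast_nonneg)
  have hlim : AEStronglyMeasurable
      (fun t => Real.exp ((1 - (β + 1)) * τ) • (C t).expNeg τ x) μ := by
    refine aestronglyMeasurable_of_tendsto_ae atTop (f := fun (n : ℕ) t =>
      (∫ v in Set.Icc (0 : ℝ) 1, (1 - (v - Real.exp (-τ)) ^ 2) ^ n)⁻¹ •
        ∑ k ∈ (peakPoly (Real.exp (-τ)) n).support, (peakPoly (Real.exp (-τ)) n).coeff k •
          (C t).shiftInv ((β + 1 + k : ℝ) : ℂ) x) (fun n => ?_) ?_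
    · exact (Finset.aestronglyMeasurable_fun_sum _ fun k _ =>
        (hmeas _ (hβk k) x).const_smul _).const_smul _
    · filter_upwards [hclass] with t ht
      obtain ⟨S, hS, hexp, hle⟩ := ht.exists_semigroup
      have h1 := tendsto_laplace_inversion (S.continuous_orbit_toNNReal x)
        (C0Semigroup.norm_orbit_le hle x) hβ τ.2
      simp only [NNReal.val_eq_coe, Real.toNNReal_coe] at h1
      rw [hexp]
      refine h1.congr fun n => ?_
      congr 1
      refine Finset.sum_congr rfl fun k _ => ?_
      obtain ⟨R, hR, hR1, -⟩ := C0Semigroup.exists_isShiftInverse hle (hβk k)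
      rw [← hR1, ← hS, hR.shiftInv_eq]
  have := hlim.const_smul (Real.exp ((1 - (β + 1)) * τ))⁻¹
  refine this.congr (Eventually.of_forall fun t => ?_)
  exact inv_smul_smul₀ (Real.exp_pos _).ne' _

variable {X : Type*} [NormedAddCommGroup X] [NormedSpace ℂ X] [CompleteSpace X] {μ : Measure ℝ}
  {p : ℝ≥0∞} [Fact (1 ≤ p)] {C : ℝ → X →ₗ.[ℂ] X} {M β : ℝ}

theorem exists_semigroup_Lp (hp : p ≠ ∞) (hM : 0 ≤ M)
    (hclass : ∀ᵐ t ∂μ, (C t).IsOfClassG M β)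
    (hmeas : ∀ ξ : ℝ, β < ξ → ∀ x : X,
      AEStronglyMeasurable (fun t => (C t).shiftInv (ξ : ℂ) x) μ) :
    ∃ S : C0Semigroup (Lp X p μ),
      (∀ τ f, ∀ᵐ t ∂μ, S.op τ f t = (C t).expNeg τ (f t)) ∧
      ∀ τ : ℝ≥0, ‖S.op τ‖ ≤ M * Real.exp (β * τ) := by
  choose L hL hLnorm using fun τ : ℝ≥0 => exists_Lp_multiplication p
    (by positivity : 0 ≤ M * Real.exp (β * τ)) (hclass.mono fun t ht => ht.2 τ)
    (aestronglyMeasurable_expNeg hclass hmeas τ)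
  refine ⟨⟨L, ?_, ?_, ?_⟩, hL, hLnorm⟩
  · ext1 f
    refine Lp.ext ?_
    filter_upwards [hL 0 f, hclass] with t ht hc
    obtain ⟨S, -, hexp, -⟩ := hc.exists_semigroup
    rw [ht, hexp, S.op_zero]
    rfl
  · intro s τ
    ext1 f
    refine Lp.ext ?_
    filter_upwards [hL (s + τ) f, hL s (L τ f), hL τ f, hclass] with t h1 h2 h3 hc
    obtain ⟨S, -, hexp, -⟩ := hc.exists_semigroup
    rw [h1, ContinuousLinearMap.comp_apply, h2, h3, hexp, hexp, hexp, S.op_add]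
    rfl
  · intro f
    -- The fibre identities hold off a null set depending on τ; along a sequence only countably many
    -- such sets occur.
    refine continuous_iff_seqContinuous.2 fun τ τ₀ hτ => ?_
    obtain ⟨r, hr⟩ := (hτ.bddAbove_range : BddAbove (Set.range τ))
    have hr' : ∀ n, τ n ≤ r := fun n => hr ⟨n, rfl⟩
    have hr₀ : τ₀ ≤ r := le_of_tendsto' hτ hr'
    have hexpr : ∀ s ≤ r, M * Real.exp (β * s) ≤ M * Real.exp (|β| * r) := fun s hs => by
      gcongr
      exact le_abs_self β
    change Tendsto (fun n => L (τ n) f) atTop (𝓝 (L τ₀ f))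
    refine tendsto_Lp_of_dominated hp
      (bound := fun t => (2 * (M * Real.exp (|β| * r))) * ‖f t‖)
      ((Lp.memLp f).norm.const_mul _) (fun n => ?_) ?_
    · filter_upwards [hL (τ n) f, hL τ₀ f, hclass] with t h1 h2 hc
      rw [h1, h2, two_mul, add_mul]
      exact (norm_sub_le _ _).trans (add_le_add
        (ContinuousLinearMap.le_of_opNorm_le _ ((hc.2 _).trans (hexpr _ (hr' n))) _)
        (ContinuousLinearMap.le_of_opNorm_le _ ((hc.2 _).trans (hexpr _ hr₀)) _))
    · filter_upwards [ae_all_iff.2 fun n => hL (τ n) f, hL τ₀ f, hclass] with t h1 h2 hc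
      obtain ⟨S, -, hexp, -⟩ := hc.exists_semigroup
      simp_rw [h1, h2, hexp]
      exact ((S.continuous_orbit (f t)).tendsto τ₀).comp hτ

theorem generator_graph_le_induced_graph {S : C0Semigroup (Lp X p μ)}
    (hclass : ∀ᵐ t ∂μ, (C t).IsOfClassG M β)
    (hS : ∀ τ f, ∀ᵐ t ∂μ, S.op τ f t = (C t).expNeg τ (f t)) :
    S.generator.graph ≤ (induced C p μ).graph := by
  rintro ⟨f, g⟩ hfg
  rw [mem_graph_induced]
  rw [C0Semigroup.mem_graph_generator] at hfg
  obtain ⟨h, hh⟩ := exists_seq_tendsto (𝓝[>] (0 : ℝ≥0))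
  obtain ⟨φ, hφ, hlim⟩ := (tendstoInMeasure_of_tendsto_Lp (hfg.comp hh)).exists_seq_tendsto_ae
  have hae : ∀ n, ∀ᵐ t ∂μ, (((h n : ℝ) : ℂ)⁻¹ • (f - S.op (h n) f) : Lp X p μ) t =
      ((h n : ℝ) : ℂ)⁻¹ • (f t - (C t).expNeg (h n) (f t)) := fun n => by
    filter_upwards [Lp.coeFn_smul ((h n : ℝ) : ℂ)⁻¹ (f - S.op (h n) f),
      Lp.coeFn_sub f (S.op (h n) f), hS (h n) f] with t h1 h2 h3
    rw [h1, Pi.smul_apply, h2, Pi.sub_apply, h3]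
  filter_upwards [hlim, ae_all_iff.2 hae, hclass] with t ht h1 hc
  obtain ⟨St, hSt, hexp, -⟩ := hc.exists_semigroup
  have hmem : (f t, g t) ∈ (C t).graph := by
    rw [← hSt]
    refine St.mem_graph_generator_of_tendsto_seq (hh.comp hφ.tendsto_atTop) (ht.congr fun n => ?_)
    simp only [Function.comp]
    rw [h1, hexp, ← Complex.ofReal_inv, Complex.coe_smul]
  obtain ⟨y, hy, hy'⟩ := (mem_graph_iff _).1 hmem
  simp only at hy hy'
  refine ⟨hy ▸ y.2, ?_⟩
  rw [← hy']
  congr 1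
  exact Subtype.ext hy.symm

theorem generator_eq_induced {S : C0Semigroup (Lp X p μ)}
    (hclass : ∀ᵐ t ∂μ, (C t).IsOfClassG M β)
    (hS : ∀ τ f, ∀ᵐ t ∂μ, S.op τ f t = (C t).expNeg τ (f t))
    (hle : ∀ τ : ℝ≥0, ‖S.op τ‖ ≤ M * Real.exp (β * τ)) :
    S.generator = induced C p μ := by
  have hβ := lt_add_one β
  obtain ⟨R, hR, -⟩ := C0Semigroup.exists_isShiftInverse hle hβ
  -- It remains to show 𝒞 + β + 1 injective, which holds because C(t) + β + 1 is invertible for a.e.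
  -- t.
  refine hR.eq_of_graph_le (generator_graph_le_induced_graph hclass hS) fun f hf => ?_
  rw [mem_graph_induced] at hf
  refine Lp.ext ?_
  filter_upwards [hf, hclass, Lp.coeFn_neg (((β + 1 : ℝ) : ℂ) • f),
    Lp.coeFn_smul ((β + 1 : ℝ) : ℂ) f, Lp.coeFn_zero X p μ] with t ht hc h1 h2 h3
  obtain ⟨St, hSt, -, hlet⟩ := hc.exists_semigroup
  obtain ⟨Rt, hRt, -⟩ := C0Semigroup.exists_isShiftInverse hlet hβ
  rw [hSt] at hRt
  obtain ⟨hdom, hval⟩ := ht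
  have := hRt.2 ⟨f t, hdom⟩
  rw [hval, h1, Pi.neg_apply, h2, Pi.smul_apply, neg_add_cancel] at this
  rw [h3]
  exact this.symm.trans Rt.map_zero

end LinearPMap

theorem mainTheorem8 {X : Type*} [NormedAddCommGroup X] [NormedSpace ℂ X] [CompleteSpace X]
    [TopologicalSpace.SeparableSpace X]
    (T : ℝ) (hT : 0 < T) (p : ℝ≥0∞) [Fact (1 ≤ p)] (hp : p ≠ ∞)
    (C : ℝ → X →ₗ.[ℂ] X) (M β : ℝ) (hM : 1 ≤ M)
    (hgen : ∀ t ∈ Set.Icc 0 T, (C t).IsGenerator)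
    (hclass : ∀ᵐ t ∂(volume.restrict (Set.Icc 0 T)), (C t).IsOfClassG M β)
    (hmeas : ∀ ξ : ℝ, β < ξ → ∀ x : X,
      AEStronglyMeasurable (fun t => (C t).shiftInv (ξ : ℂ) x) (volume.restrict (Set.Icc 0 T))) :
    (LinearPMap.induced C p (volume.restrict (Set.Icc 0 T))).IsOfClassG M β ∧
      ∀ (τ : ℝ≥0) (f : Lp X p (volume.restrict (Set.Icc 0 T))),
        ∀ᵐ t ∂(volume.restrict (Set.Icc 0 T)),
          (LinearPMap.induced C p (volume.restrict (Set.Icc 0 T))).expNeg τ f t =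
            (C t).expNeg τ (f t) := by
  obtain ⟨S, hS, hle⟩ := LinearPMap.exists_semigroup_Lp hp (zero_le_one.trans hM) hclass hmeas
  rw [← LinearPMap.generator_eq_induced hclass hS hle]
  simp_rw [LinearPMap.IsOfClassG, S.expNeg_generator]
  exact ⟨⟨S.isGenerator_generator, hle⟩, hS⟩
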